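/- Let $\mathcal Z=\{z_{n,j}\}$, $n=0,1,2,\dots$, $j=0,\dots,m_n$, be a triangular family of points of the unit circle $\mathbb T$. For $1\le p<\infty$, $\mathcal Z$ is called a Marcinkiewicz–Zygmund (M-Z) family for $L^p$ if there is a constant $C_p>0$ such that for every $n\ge 1$ and every holomorphic polynomial $q$ of degree at most $n$ $$\frac{C_p^{-1}}{m_n}\sum_{j=0}^{m_n}|q(z_{n,j})|^p\le\int_0^{2\pi}|q(e^{i\theta})|^p\,d\theta\le\frac{C_p}{m_n}\sum_{j=0}^{m_n}|q(z_{n,j})|^p .$$ It is called an M-Z family for $L^\infty$ if there is a constant $C>0$ such that for every $n\ge 0$ and every holomorphic polynomial $q$ of degree at most $n$ $$\sup_{|z|=1}|q(z)|\le C\sup_{j=0,\dots,m_n}|q(z_{n,j})| .$$ An M-Z family is called minimal if $m_n=n$ for all $n$. Theorem. There is no minimal M-Z family for $L^1$, and there is no minimal M-Z family for $L^\infty$. -/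

import Mathlib

/-- A triangular family of points `z_{n,j}`, `n = 0, 1, 2, …`, `j = 0, …, m_n`, of the unit circle
(generation `n` has `m_n + 1` entries). -/
structure TriangularFamily where
  /-- the index of the last point of each generation -/
  m : ℕ → ℕ
  /-- the points -/
  z : (n : ℕ) → Fin (m n + 1) → Circle

namespace TriangularFamily

/-- Marcinkiewicz-Zygmund family for `L^p`, `1 ≤ p < ∞`. The inequalities are normalized by `1 / m_n`
and so are required in the degrees `n ≥ 1` (for `n = 0` the polynomials are constants, and the
inequalities are either automatic, with a suitable constant, or meaningless because `m_0 = 0`). -/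
def IsMZ (Z : TriangularFamily) (p : ℝ) : Prop :=
  ∃ C : ℝ, 0 < C ∧ ∀ n : ℕ, 1 ≤ n → ∀ q : Polynomial ℂ, q.natDegree ≤ n →
    C⁻¹ / (Z.m n : ℝ) * ∑ j : Fin (Z.m n + 1), ‖q.eval (Z.z n j : ℂ)‖ ^ p
        ≤ ∫ θ in (0 : ℝ)..(2 * Real.pi), ‖q.eval (Circle.exp θ : ℂ)‖ ^ p ∧
      ∫ θ in (0 : ℝ)..(2 * Real.pi), ‖q.eval (Circle.exp θ : ℂ)‖ ^ p
        ≤ C / (Z.m n : ℝ) * ∑ j : Fin (Z.m n + 1), ‖q.eval (Z.z n j : ℂ)‖ ^ p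

/-- Marcinkiewicz-Zygmund family for `L^∞`. -/
def IsMZTop (Z : TriangularFamily) : Prop :=
  ∃ C : ℝ, 0 < C ∧ ∀ n : ℕ, ∀ q : Polynomial ℂ, q.natDegree ≤ n →
    (⨆ w : Circle, ‖q.eval (w : ℂ)‖) ≤ C * ⨆ j : Fin (Z.m n + 1), ‖q.eval (Z.z n j : ℂ)‖

/-- The minimality condition `m_n = n` for all `n`. -/
def IsMinimal (Z : TriangularFamily) : Prop :=
  ∀ n : ℕ, Z.m n = n

end TriangularFamily

open Polynomial intervalIntegral

/-! With `n + 1` nodes, the upper M-Z inequality forces them to be distinct, so there are Lagrange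
basis polynomials `ℓ_j`. Rotating each `ℓ_j` by its own node and summing gives `∑ j, ℓ_j (z_j w) = 1
+ w + ⋯ + w ^ n`, wherever the nodes lie. Rotations preserve the `L¹` norm, so the norms of the
`ℓ_j` sum to at least that of this kernel, which is at least twice the harmonic sum. The M-Z bounds
keep the sum of norms bounded: for `L¹` by testing on each `ℓ_j`, for `L^∞` by integrating the
Lebesgue function. -/

/-- A polynomial vanishing on the unit circle is zero. -/
theorem Polynomial.eq_zero_of_forall_circle {q : ℂ[X]} (h : ∀ w : Circle, q.eval (w : ℂ) = 0) :
    q = 0 := by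
  have : Infinite (Set.Ioc (-Real.pi) Real.pi) :=
    (Set.Ioc_infinite (by linarith [Real.pi_pos])).to_subtype
  have : Infinite Circle := Circle.argEquiv.symm.infinite_iff.mp this
  exact Polynomial.eq_zero_of_infinite_isRoot q
    ((Set.infinite_range_of_injective (α := Circle) Circle.coe_injective).mono
      (by rintro _ ⟨w, rfl⟩; exact h w))

/-- If the values at `n + 1` points determine the polynomials of degree at most `n`, then the points
are distinct. -/
theorem injective_of_eval_determines {n : ℕ} (z : Fin (n + 1) → ℂ)
    (h : ∀ q : ℂ[X], q.natDegree ≤ n → (∀ j, q.eval (z j) = 0) → q = 0) :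
    Function.Injective z := by
  classical
  by_contra hz
  have hcard : (Finset.univ.image z).card ≤ n := by
    have hle : (Finset.univ.image z).card ≤ n + 1 := by
      simpa using Finset.card_image_le (s := Finset.univ) (f := z)
    have hne : (Finset.univ.image z).card ≠ n + 1 := fun he => hz <| by
      have hcard : (Finset.univ.image z).card = (Finset.univ : Finset (Fin (n + 1))).card := by
        simpa using he
      simpa using Finset.card_image_iff.mp hcard
    omega
  -- The nodal polynomial of the at most `n` distinct nodes is a nonzero counterexample to `h`.
  refine (Lagrange.nodal_ne_zero (s := Finset.univ.image z) (v := (id : ℂ → ℂ)))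
    (h _ (by rwa [Lagrange.natDegree_nodal]) fun j => ?_)
  exact Lagrange.eval_nodal_at_node (v := (id : ℂ → ℂ))
    (Finset.mem_image_of_mem z (Finset.mem_univ j))

theorem natDegree_lagrange_basis_le {n : ℕ} {z : Fin (n + 1) → ℂ} (hz : Function.Injective z)
    (j : Fin (n + 1)) : (Lagrange.basis Finset.univ z j).natDegree ≤ n := by
  refine natDegree_le_of_degree_le ?_
  rw [Lagrange.degree_basis hz.injOn (Finset.mem_univ j)]
  simp

/-- The dilated Lagrange basis polynomials sum to the analytic Dirichlet kernel. -/
theorem sum_eval_lagrange_basis_mul {n : ℕ} {z : Fin (n + 1) → ℂ} (hz : Function.Injective z)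
    (w : ℂ) : ∑ j, (Lagrange.basis Finset.univ z j).eval (z j * w) =
      ∑ b ∈ Finset.range (n + 1), w ^ b := by
  have hcoeff : ∀ b ∈ Finset.range (n + 1),
      ∑ j, (Lagrange.basis Finset.univ z j).coeff b * z j ^ b = 1 := fun b hb => by
    -- Since `b ≤ n`, `X ^ b` is its own interpolant; compare coefficients of `X ^ b`.
    have hX : (X ^ b : ℂ[X]) = Lagrange.interpolate Finset.univ z fun j => z j ^ b := by
      refine Lagrange.eq_interpolate_of_eval_eq _ hz.injOn ?_ fun j _ => by simp
      rw [degree_X_pow]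
      rw [Finset.card_univ, Fintype.card_fin]
      exact_mod_cast Finset.mem_range.mp hb
    have := congrArg (fun p => coeff p b) hX
    simp only [Lagrange.interpolate_apply, finsetSum_coeff, coeff_C_mul, coeff_X_pow_self] at this
    rw [this]
    exact Finset.sum_congr rfl fun _ _ => mul_comm _ _
  simp_rw [fun j => eval_eq_sum_range' (Nat.lt_succ_of_le (natDegree_lagrange_basis_le hz j))
    (z j * w)]
  rw [Finset.sum_comm]
  refine Finset.sum_congr rfl fun b hb => ?_
  simp_rw [mul_pow, ← mul_assoc]
  rw [← Finset.sum_mul, hcoeff b hb, one_mul]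

/-! ### `L¹` norms on the circle and the Dirichlet kernel -/

theorem continuous_norm_eval_circleExp (q : ℂ[X]) :
    Continuous fun θ : ℝ => ‖q.eval (Circle.exp θ : ℂ)‖ :=
  (q.continuous.comp (by fun_prop : Continuous fun θ : ℝ => (Circle.exp θ : ℂ))).norm

/-- The `L¹` norm on the circle is invariant under rotations. -/
theorem integral_norm_eval_rotate (q : ℂ[X]) (u : Circle) :
    ∫ θ in (0 : ℝ)..(2 * Real.pi), ‖q.eval ((u : ℂ) * (Circle.exp θ : ℂ))‖ =
      ∫ θ in (0 : ℝ)..(2 * Real.pi), ‖q.eval (Circle.exp θ : ℂ)‖ := by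
  have hper : Function.Periodic (fun θ : ℝ => ‖q.eval (Circle.exp θ : ℂ)‖) (2 * Real.pi) :=
    fun θ => by simp only [Circle.periodic_exp θ]
  have hrot : ∀ θ : ℝ, ((u : ℂ) * (Circle.exp θ : ℂ)) = (Circle.exp (θ + Complex.arg u) : ℂ) :=
    fun θ => by rw [Circle.exp_add, Circle.exp_arg, Circle.coe_mul, mul_comm]
  simp_rw [hrot]
  rw [integral_comp_add_right (fun θ : ℝ => ‖q.eval (Circle.exp θ : ℂ)‖), zero_add, add_comm]
  simpa using hper.intervalIntegral_add_eq (Complex.arg u) 0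

/-- Fourier coefficients of the sawtooth `π - θ`. -/
theorem integral_sawtooth_mul_exp (k : ℕ) :
    ∫ θ in (0 : ℝ)..(2 * Real.pi),
        ((Real.pi - θ : ℝ) : ℂ) * Complex.exp (-(k * Complex.I) * θ) =
      -(2 * Real.pi * Complex.I) * (k : ℂ)⁻¹ := by
  rcases Nat.eq_zero_or_pos k with rfl | hk
  -- The sawtooth has mean zero, in agreement with the convention `0⁻¹ = 0`.
  · simp only [CharP.cast_eq_zero, zero_mul, neg_zero, Complex.exp_zero, mul_one, inv_zero, mul_zero]
    rw [integral_ofReal, integral_sub (by simp) (by simp), integral_id, integral_const]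
    norm_num
    ring
  have hk0 : (k : ℂ) ≠ 0 := by exact_mod_cast hk.ne'
  set c : ℂ := -(k * Complex.I) with hc
  have hc0 : c ≠ 0 := by simp [hc, hk0]
  have hderiv : ∀ θ : ℝ, HasDerivAt
      (fun θ : ℝ => (c⁻¹ * ((Real.pi - θ : ℝ) : ℂ) + c⁻¹ * c⁻¹) * Complex.exp (c * θ))
      (((Real.pi - θ : ℝ) : ℂ) * Complex.exp (c * θ)) θ := fun θ => by
    have h1 : HasDerivAt (fun θ : ℝ => ((Real.pi - θ : ℝ) : ℂ)) (-1) θ := by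
      simpa using ((hasDerivAt_id θ).const_sub Real.pi).ofReal_comp
    have h2 : HasDerivAt (fun θ : ℝ => Complex.exp (c * θ)) (Complex.exp (c * θ) * c) θ := by
      simpa using ((Complex.ofRealCLM.hasDerivAt (x := θ)).const_mul c).cexp
    refine (((h1.const_mul c⁻¹).add_const (c⁻¹ * c⁻¹)).mul h2).congr_deriv ?_
    field_simp
    ring
  have hexp : Complex.exp (c * ((2 * Real.pi : ℝ) : ℂ)) = 1 := by
    rw [Complex.exp_eq_one_iff]
    exact ⟨-k, by rw [hc]; push_cast; ring⟩
  rw [integral_eq_sub_of_hasDerivAt (fun θ _ => hderiv θ)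
    (Continuous.intervalIntegrable (by fun_prop) _ _), hexp, hc]
  push_cast
  simp only [mul_zero, Complex.exp_zero]
  field_simp
  linear_combination (2 * k * Real.pi * Complex.I) * Complex.I_sq

/-- The `L¹` norm of the Dirichlet kernel grows at least like the harmonic series. -/
theorem two_mul_harmonic_le_integral_norm_dirichlet (n : ℕ) :
    2 * (harmonic n : ℝ) ≤ ∫ θ in (0 : ℝ)..(2 * Real.pi),
      ‖∑ b ∈ Finset.range (n + 1), (Circle.exp θ : ℂ) ^ b‖ := by
  -- Pairing with the sawtooth shifted by frequency `n` reverses the sum through `b = n - k`, so all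
  -- its coefficients `1 / k` enter with the same phase and add up.
  have hkernel : ∀ θ : ℝ, (∑ b ∈ Finset.range (n + 1), (Circle.exp θ : ℂ) ^ b) *
      (((Real.pi - θ : ℝ) : ℂ) * Complex.exp (-(n * Complex.I) * θ)) =
      ∑ k ∈ Finset.range (n + 1),
        ((Real.pi - θ : ℝ) : ℂ) * Complex.exp (-(k * Complex.I) * θ) := fun θ => by
    rw [← Finset.sum_range_reflect (fun b => (Circle.exp θ : ℂ) ^ b), Finset.sum_mul]
    refine Finset.sum_congr rfl fun k hk => ?_
    have hkn : k ≤ n := Nat.lt_succ_iff.mp (Finset.mem_range.mp hk)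
    rw [Circle.coe_exp, ← Complex.exp_nat_mul, mul_left_comm, ← Complex.exp_add]
    congr 2
    rw [Nat.add_sub_cancel, Nat.cast_sub hkn]
    ring
  have hint : ∫ θ in (0 : ℝ)..(2 * Real.pi),
      (∑ b ∈ Finset.range (n + 1), (Circle.exp θ : ℂ) ^ b) *
        (((Real.pi - θ : ℝ) : ℂ) * Complex.exp (-(n * Complex.I) * θ)) =
      -(2 * Real.pi * Complex.I) * ((harmonic n : ℝ) : ℂ) := by
    simp_rw [hkernel]
    rw [integral_finsetSum fun k _ => Continuous.intervalIntegrable (by fun_prop) _ _]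
    simp_rw [integral_sawtooth_mul_exp]
    rw [← Finset.mul_sum, Finset.sum_range_succ']
    simp [harmonic]
  have hharm : (0 : ℝ) ≤ harmonic n := by
    exact_mod_cast Finset.sum_nonneg fun i _ => by positivity
  have hnorm : 2 * Real.pi * (harmonic n : ℝ) ≤ ∫ θ in (0 : ℝ)..(2 * Real.pi),
      Real.pi * ‖∑ b ∈ Finset.range (n + 1), (Circle.exp θ : ℂ) ^ b‖ := by
    calc 2 * Real.pi * (harmonic n : ℝ)
        = ‖-(2 * Real.pi * Complex.I) * ((harmonic n : ℝ) : ℂ)‖ := by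
          rw [norm_mul, norm_neg, norm_mul, Complex.norm_I, Complex.norm_real,
            Real.norm_of_nonneg hharm]
          simp [abs_of_pos Real.pi_pos]
      _ ≤ _ := by
          rw [← hint]
          refine norm_integral_le_of_norm_le (by positivity)
            (MeasureTheory.ae_of_all _ fun θ hθ => ?_)
            (Continuous.intervalIntegrable (by fun_prop) _ _)
          have hexp : ‖Complex.exp (-(n * Complex.I) * θ)‖ = 1 := by
            rw [Complex.norm_exp]; simp
          rw [norm_mul, norm_mul, hexp, mul_one, Complex.norm_real, mul_comm]
          gcongr
          -- On the period the sawtooth is at most `π` in modulus; this `π` cancels that of its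
          -- coefficients.
          rw [Real.norm_eq_abs, abs_le]
          constructor <;> linarith [hθ.1, hθ.2]
  rw [integral_const_mul] at hnorm
  nlinarith [Real.pi_pos]

/-! ### Norms of Lagrange bases -/

/-- The `L¹` norms of the Lagrange basis polynomials at `n + 1` points of the circle sum to at least
the `L¹` norm of the Dirichlet kernel. -/
theorem two_mul_harmonic_le_sum_integral_lagrange_basis {n : ℕ} {z : Fin (n + 1) → Circle}
    (hz : Function.Injective fun j => (z j : ℂ)) :
    2 * (harmonic n : ℝ) ≤ ∑ j, ∫ θ in (0 : ℝ)..(2 * Real.pi),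
      ‖(Lagrange.basis Finset.univ (fun j => (z j : ℂ)) j).eval (Circle.exp θ : ℂ)‖ := by
  have hcont : ∀ j, Continuous fun θ : ℝ =>
      (Lagrange.basis Finset.univ (fun j => (z j : ℂ)) j).eval
        ((z j : ℂ) * (Circle.exp θ : ℂ)) :=
    fun j => (Polynomial.continuous _).comp (by fun_prop : Continuous fun θ : ℝ =>
      (z j : ℂ) * (Circle.exp θ : ℂ))
  refine (two_mul_harmonic_le_integral_norm_dirichlet n).trans ?_
  simp_rw [← fun j => integral_norm_eval_rotate
    (Lagrange.basis Finset.univ (fun j => (z j : ℂ)) j) (z j)]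
  rw [← integral_finsetSum fun j _ => (hcont j).norm.intervalIntegrable _ _]
  refine integral_mono_on (by positivity) (Continuous.intervalIntegrable (by fun_prop) _ _)
    (Continuous.intervalIntegrable (continuous_finsetSum _ fun j _ => (hcont j).norm) _ _)
    fun θ _ => ?_
  rw [← sum_eval_lagrange_basis_mul hz]
  exact norm_sum_le _ _

/-- If polynomials of degree at most `n` bounded by `1` at the `n + 1` nodes are bounded by `C` at
`w`, then the Lebesgue function of the nodes is at most `C` at `w`. -/
theorem sum_norm_eval_lagrange_basis_le {n : ℕ} {z : Fin (n + 1) → ℂ} (hz : Function.Injective z)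
    {C : ℝ} {w : ℂ}
    (h : ∀ q : ℂ[X], q.natDegree ≤ n → (∀ j, ‖q.eval (z j)‖ ≤ 1) → ‖q.eval w‖ ≤ C) :
    ∑ j, ‖(Lagrange.basis Finset.univ z j).eval w‖ ≤ C := by
  -- The extremal polynomial interpolates the phases `u j`, which make every term at `w`
  -- nonnegative.
  have hphase : ∀ a : ℂ, ∃ u : ℂ, ‖u‖ ≤ 1 ∧ u * a = ‖a‖ := fun a => by
    rcases eq_or_ne a 0 with rfl | ha
    · exact ⟨0, by simp⟩
    · exact ⟨‖a‖ / a, by simp [ha], div_mul_cancel₀ _ ha⟩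
  choose u hu1 hu using fun j => hphase ((Lagrange.basis Finset.univ z j).eval w)
  have hdeg : (Lagrange.interpolate Finset.univ z u).natDegree ≤ n := by
    rw [Lagrange.interpolate_apply]
    exact natDegree_sum_le_of_forall_le _ _ fun j _ =>
      (natDegree_C_mul_le _ _).trans (natDegree_lagrange_basis_le hz j)
  have hval := h _ hdeg fun j => by
    rw [Lagrange.eval_interpolate_at_node u hz.injOn (Finset.mem_univ j)]
    exact hu1 j
  have heq : (Lagrange.interpolate Finset.univ z u).eval w =
      ((∑ j, ‖(Lagrange.basis Finset.univ z j).eval w‖ : ℝ) : ℂ) := by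
    rw [Lagrange.interpolate_apply, eval_finsetSum, Complex.ofReal_sum]
    exact Finset.sum_congr rfl fun j _ => by rw [eval_mul, eval_C, ← hu j]
  rwa [heq, Complex.norm_real,
    Real.norm_of_nonneg (Finset.sum_nonneg fun _ _ => norm_nonneg _)] at hval

theorem exists_lt_harmonic (B : ℝ) : ∃ n : ℕ, 1 ≤ n ∧ B < harmonic n := by
  obtain ⟨n, hn⟩ := exists_nat_gt (Real.exp B)
  refine ⟨n, Nat.one_le_iff_ne_zero.mpr fun h => ?_, ?_⟩
  · subst h
    exact absurd hn (by simpa using (Real.exp_pos B).le)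
  · refine lt_of_lt_of_le ?_ (log_add_one_le_harmonic n)
    rw [Real.lt_log_iff_exp_lt (by positivity)]
    push_cast
    linarith

/-! ### Harmonic sums bounded by M-Z constants -/

namespace TriangularFamily

/-- The upper `L¹` inequality in degree `n` with `n + 1` points bounds the harmonic sum. -/
theorem harmonic_le_of_integral_le {n : ℕ} (hn : 1 ≤ n) {C : ℝ} (hC : 0 < C)
    {z : Fin (n + 1) → Circle}
    (h : ∀ q : ℂ[X], q.natDegree ≤ n →
      ∫ θ in (0 : ℝ)..(2 * Real.pi), ‖q.eval (Circle.exp θ : ℂ)‖ ≤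
        C / (n : ℝ) * ∑ j, ‖q.eval (z j : ℂ)‖) :
    (harmonic n : ℝ) ≤ C := by
  have hz : Function.Injective fun j => (z j : ℂ) :=
    injective_of_eval_determines _ fun q hq hq0 => eq_zero_of_forall_circle fun w => by
      by_contra hw
      have hle := h q hq
      simp only [hq0, norm_zero, Finset.sum_const_zero, mul_zero] at hle
      -- The rotation moves the point `w` where `q` is nonzero to `θ = 0`, inside the range of
      -- integration.
      have hpos : 0 < ∫ θ in (0 : ℝ)..(2 * Real.pi),
          ‖q.eval ((w : ℂ) * (Circle.exp θ : ℂ))‖ := by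
        refine integral_pos (by positivity) ?_ (fun _ _ => norm_nonneg _)
          ⟨0, by simp [Real.pi_pos.le], by simpa using hw⟩
        exact ((Polynomial.continuous q).comp (by fun_prop : Continuous fun θ : ℝ =>
          (w : ℂ) * (Circle.exp θ : ℂ))).norm.continuousOn
      rw [integral_norm_eval_rotate] at hpos
      linarith
  have hbasis : ∀ j, ∫ θ in (0 : ℝ)..(2 * Real.pi),
      ‖(Lagrange.basis Finset.univ (fun j => (z j : ℂ)) j).eval (Circle.exp θ : ℂ)‖ ≤
        C / (n : ℝ) := fun j => by
    refine (h _ (natDegree_lagrange_basis_le hz j)).trans_eq ?_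
    rw [Finset.sum_eq_single j, Lagrange.eval_basis_self hz.injOn (Finset.mem_univ j)]
    · simp
    · intro i _ hij
      rw [Lagrange.eval_basis_of_ne (v := fun j => (z j : ℂ)) hij.symm (Finset.mem_univ i),
        norm_zero]
    · simp
  have hsum := (two_mul_harmonic_le_sum_integral_lagrange_basis hz).trans
    (Finset.sum_le_sum fun j _ => hbasis j)
  have hn1 : (1 : ℝ) ≤ n := by exact_mod_cast hn
  rw [Finset.sum_const, Finset.card_univ, Fintype.card_fin, nsmul_eq_mul] at hsum
  -- As `(n + 1) / n ≤ 2`, this factor absorbs the `2` before the harmonic sum.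
  have : ((n + 1 : ℕ) : ℝ) * (C / n) ≤ 2 * C := by
    rw [mul_div_assoc', div_le_iff₀ (by linarith)]
    push_cast
    nlinarith
  linarith

/-- The supremum inequality in degree `n` with `n + 1` points bounds the harmonic sum. -/
theorem harmonic_le_of_iSup_le {n : ℕ} {C : ℝ} (hC : 0 < C) {z : Fin (n + 1) → Circle}
    (h : ∀ q : ℂ[X], q.natDegree ≤ n →
      (⨆ w : Circle, ‖q.eval (w : ℂ)‖) ≤ C * ⨆ j, ‖q.eval (z j : ℂ)‖) :
    (harmonic n : ℝ) ≤ Real.pi * C := by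
  have hpt : ∀ q : ℂ[X], q.natDegree ≤ n → ∀ B : ℝ, (∀ j, ‖q.eval (z j : ℂ)‖ ≤ B) →
      ∀ w : Circle, ‖q.eval (w : ℂ)‖ ≤ C * B := fun q hq B hB w => by
    have hbdd : BddAbove (Set.range fun w : Circle => ‖q.eval (w : ℂ)‖) :=
      (isCompact_range ((Polynomial.continuous q).comp
        (by fun_prop : Continuous fun w : Circle => (w : ℂ))).norm).bddAbove
    refine (le_ciSup hbdd w).trans ((h q hq).trans ?_)
    exact mul_le_mul_of_nonneg_left (ciSup_le hB) hC.le
  have hz : Function.Injective fun j => (z j : ℂ) :=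
    injective_of_eval_determines _ fun q hq hq0 => eq_zero_of_forall_circle fun w => by
      -- The bound `B = 0` at the nodes gives `0` on the whole circle.
      simpa using hpt q hq 0 (fun j => by simp [hq0 j]) w
  have hsum := two_mul_harmonic_le_sum_integral_lagrange_basis hz
  rw [← integral_finsetSum fun j _ =>
    (continuous_norm_eval_circleExp _).intervalIntegrable _ _] at hsum
  have hle : ∫ θ in (0 : ℝ)..(2 * Real.pi), ∑ j,
      ‖(Lagrange.basis Finset.univ (fun j => (z j : ℂ)) j).eval (Circle.exp θ : ℂ)‖ ≤
      ∫ _θ in (0 : ℝ)..(2 * Real.pi), C :=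
    integral_mono_on (by positivity)
      (Continuous.intervalIntegrable
        (continuous_finsetSum _ fun j _ => continuous_norm_eval_circleExp _) _ _)
      (by simp) fun θ _ =>
        sum_norm_eval_lagrange_basis_le hz fun q hq hq1 => by
          simpa only [mul_one] using hpt q hq 1 hq1 (Circle.exp θ)
  rw [integral_const, sub_zero, smul_eq_mul] at hle
  linarith

end TriangularFamily

theorem theorem2 :
    (¬ ∃ Z : TriangularFamily, Z.IsMinimal ∧ Z.IsMZ 1) ∧
      (¬ ∃ Z : TriangularFamily, Z.IsMinimal ∧ Z.IsMZTop) := by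
  constructor
  · rintro ⟨⟨m, z⟩, hmin, C, hC, h⟩
    obtain rfl : m = id := funext hmin
    obtain ⟨n, hn, hlt⟩ := exists_lt_harmonic C
    refine hlt.not_ge (TriangularFamily.harmonic_le_of_integral_le hn hC (z := z n) fun q hq => ?_)
    simpa only [Real.rpow_one, id] using (h n hn q hq).2
  · rintro ⟨⟨m, z⟩, hmin, C, hC, h⟩
    obtain rfl : m = id := funext hmin
    obtain ⟨n, -, hlt⟩ := exists_lt_harmonic (Real.pi * C)
    exact hlt.not_ge (TriangularFamily.harmonic_le_of_iSup_le hC (z := z n) (h n))
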